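/- Let $G\rightrightarrows M$ be a Lie groupoid over finite-dimensional smooth manifolds ($M$ Hausdorff), with source $\alpha$, target $\beta$ (both submersions), identities $\epsilon$, inversion $i$, and product $gh$ defined when $\beta(g)=\alpha(h)$. For $g\in G$ let $l_g(h)=gh$ on $\alpha^{-1}(\beta(g))$ and $r_g(h)=hg$ on $\beta^{-1}(\alpha(g))$. Let $\tau:AG\to M$, $A_xG=\ker T_{\epsilon(x)}\alpha$, be the Lie algebroid of $G$. For a smooth section $X$ of $AG$ put $$\overleftarrow{X}(g)=(T_{\epsilon(\beta(g))}l_g)(X(\beta(g))),\qquad \overrightarrow{X}(g)=-(T_{\epsilon(\alpha(g))}r_g)\big((T_{\epsilon(\alpha(g))}i)(X(\alpha(g)))\big).$$ Let $L_d:G\to\mathbb R$ be differentiable (for instance smooth). A pair $(g,h)\in G\times G$ is a solution of the discrete Euler–Lagrange equations for $L_d$ if $\beta(g)=\alpha(h)$ and $\overleftarrow{X}(g)(L_d)-\overrightarrow{X}(h)(L_d)=0$ for every smooth section $X$ of $AG$. Let $g_0,h_0\in G$ with $\beta(g_0)=\alpha(h_0)=x_0$. Let $(x^i,u^\gamma)$,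 $1\le i\le n$, $1\le\gamma\le m$, be smooth local coordinates on an open set $\mathcal U\subset G$, adapted to smooth local coordinates $(x^i)$ on an open subset of $M$ containing $\alpha(\mathcal U)$: if $g\in\mathcal U$ has coordinates $(x,u)$ then $\alpha(g)$ has coordinates $x$; and the identities in $\mathcal U$ have coordinates $(x,0)$. Let $\mathcal W\subset\mathcal U$ be a symmetric neighborhood associated with $\mathcal U$ and $x_0$, that is, an open set with $\epsilon(x_0)\in\mathcal W$, $\epsilon(\alpha(\mathcal W))\subset\mathcal W$, $\epsilon(\beta(\mathcal W))\subset\mathcal W$, $i(\mathcal W)=\mathcal W$, and $gh\in\mathcal U$ for all composable $g,h\in\mathcal W$. Denote by $\mathsf b(x,u)$ the coordinates of $\beta(g)$ when $g\in\mathcal W$ has coordinates $(x,u)$, define $\mathsf p$ by $(x,u)\cdot(\mathsf b(x,u),v)=(x,\mathsf p(x,u,v))$, and put $$\rho^i_\gamma(x)=\frac{\partial \mathsf b^i}{\partial u^\gamma}(x,0),\qquad L^\gamma_\mu(x,u)=\frac{\partial \mathsf p^\gamma}{\partial v^\mu}(x,u,0),\qquad R^\gamma_\mu(x,v)=\frac{\partial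 \mathsf p^\gamma}{\partial u^\mu}(x,0,v).$$ A local bisection of $G$ is an embedded submanifold $\Sigma\subset G$ such that $\alpha|_\Sigma$ and $\beta|_\Sigma$ are diffeomorphisms onto open subsets of $M$, with inverses $\Sigma_\alpha$ and $\Sigma_\beta$; it defines $L_\Sigma(g)=\Sigma_\beta(\alpha(g))\,g$ for $\alpha(g)\in\beta(\Sigma)$ and $R_\Sigma(g)=g\,\Sigma_\alpha(\beta(g))$ for $\beta(g)\in\alpha(\Sigma)$. Let $\Sigma_0\ni g_0$ and $\Upsilon_0\ni h_0$ be local bisections such that $(\Sigma_0)_\beta$ and $(\Upsilon_0)_\alpha$ are defined on $\alpha(\mathcal W)=\beta(\mathcal W)$. Let $g_{\mathcal W},h_{\mathcal W}\in\mathcal W$ have coordinates $(x,u)$ and $(y,v)$, and let $g=L_{\Sigma_0}(g_{\mathcal W})$, $h=R_{\Upsilon_0}(h_{\mathcal W})$. Then $(g,h)$ is a solution of the discrete Euler–Lagrange equations for $L_d$ if and only if $y=\mathsf b(x,u)$ and, for every $\mu=1,\dots,m$ (with summation over the repeated indices $\gamma$ and $i$), $$L^\gamma_\mu(x,u)\frac{\partial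 (L_d\circ L_{\Sigma_0})}{\partial u^\gamma}(x,u)+\rho^i_\mu(y)\frac{\partial (L_d\circ R_{\Upsilon_0})}{\partial x^i}(y,v)-R^\gamma_\mu(y,v)\frac{\partial (L_d\circ R_{\Upsilon_0})}{\partial u^\gamma}(y,v)=0,$$ where functions on $\mathcal W$ are read in the coordinates $(x,u)$. -/

import Mathlib

open scoped Manifold ContDiff

noncomputable section

/-- A Lie groupoid `G ⇉ M` over finite-dimensional real manifolds without boundary, with source `α`,
target `β`, identities `ε`, inversion `inv` and multiplication `mul`.  The pair `(g, h)` is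
composable when `β g = α h`; `mul` is a total function for convenience, and only its values on
composable pairs are constrained or used.  As `α` and `β` are submersions, the set of composable
pairs is an embedded submanifold of `G × G`, and being `C^∞` on it as a submanifold is the same as
being `C^∞` on it as a subset of `G × G`. -/
structure LieGroupoid
    (EM : Type*) [NormedAddCommGroup EM] [NormedSpace ℝ EM]
    (EG : Type*) [NormedAddCommGroup EG] [NormedSpace ℝ EG]
    (M : Type*) [TopologicalSpace M] [ChartedSpace EM M]
    (G : Type*) [TopologicalSpace G] [ChartedSpace EG G] where
  /-- source -/
  α : G → M
  /-- target -/
  β : G → M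
  /-- identities -/
  ε : M → G
  /-- inversion -/
  inv : G → G
  /-- multiplication (meaningful on composable pairs) -/
  mul : G → G → G
  α_mul : ∀ g h, β g = α h → α (mul g h) = α g
  β_mul : ∀ g h, β g = α h → β (mul g h) = β h
  mul_assoc : ∀ g h k, β g = α h → β h = α k → mul g (mul h k) = mul (mul g h) k
  α_ε : ∀ x, α (ε x) = x
  β_ε : ∀ x, β (ε x) = x
  ε_mul : ∀ g, mul (ε (α g)) g = g
  mul_ε : ∀ g, mul g (ε (β g)) = g
  α_inv : ∀ g, α (inv g) = β g
  β_inv : ∀ g, β (inv g) = α g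
  inv_mul : ∀ g, mul (inv g) g = ε (β g)
  mul_inv : ∀ g, mul g (inv g) = ε (α g)
  smooth_α : ContMDiff 𝓘(ℝ, EG) 𝓘(ℝ, EM) ∞ α
  smooth_β : ContMDiff 𝓘(ℝ, EG) 𝓘(ℝ, EM) ∞ β
  smooth_ε : ContMDiff 𝓘(ℝ, EM) 𝓘(ℝ, EG) ∞ ε
  smooth_inv : ContMDiff 𝓘(ℝ, EG) 𝓘(ℝ, EG) ∞ inv
  smooth_mul : ContMDiffOn (𝓘(ℝ, EG).prod 𝓘(ℝ, EG)) 𝓘(ℝ, EG) ∞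
    (fun q : G × G => mul q.1 q.2) {q | β q.1 = α q.2}
  submersion_α : ∀ g, Function.Surjective (mfderiv 𝓘(ℝ, EG) 𝓘(ℝ, EM) α g)
  submersion_β : ∀ g, Function.Surjective (mfderiv 𝓘(ℝ, EG) 𝓘(ℝ, EM) β g)

namespace LieGroupoid

variable {EM : Type*} [NormedAddCommGroup EM] [NormedSpace ℝ EM]
  {EG : Type*} [NormedAddCommGroup EG] [NormedSpace ℝ EG]
  {M : Type*} [TopologicalSpace M] [ChartedSpace EM M] [IsManifold 𝓘(ℝ, EM) ∞ M]
  {G : Type*} [TopologicalSpace G] [ChartedSpace EG G] [IsManifold 𝓘(ℝ, EG) ∞ G]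

/-- A smooth section `X` of the Lie algebroid `τ : AG → M`, whose fibre over `x` is
`A_x G = ker T_{ε(x)} α`.  Since `AG` is a smooth subbundle of the pullback of `TG` along `ε`,
smoothness of `X` is smoothness as a map `M → TG`. -/
structure AlgebroidSection (Γ : LieGroupoid EM EG M G) where
  /-- the value at a point -/
  toFun : ∀ x : M, TangentSpace 𝓘(ℝ, EG) (Γ.ε x)
  vertical : ∀ x, mfderiv 𝓘(ℝ, EG) 𝓘(ℝ, EM) Γ.α (Γ.ε x) (toFun x) = 0
  smooth : ContMDiff 𝓘(ℝ, EM) 𝓘(ℝ, EG).tangent ∞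
    (fun x => (⟨Γ.ε x, toFun x⟩ : TangentBundle 𝓘(ℝ, EG) G))

/-- The left-invariant vector field `g ↦ (T_{ε(β g)} l_g)(X(β g))`, where the left translation
`l_g : h ↦ g h` is defined on the fibre `α⁻¹(β g)`, so that its tangent map is the derivative within
this fibre (well defined on the vectors tangent to the fibre, such as `X(β g)`).
The value is a tangent vector at `g ε(β g) = g`. -/
def leftInv (Γ : LieGroupoid EM EG M G) (X : Γ.AlgebroidSection) (g : G) :
    TangentSpace 𝓘(ℝ, EG) g :=
  mfderivWithin 𝓘(ℝ, EG) 𝓘(ℝ, EG) (fun h => Γ.mul g h) (Γ.α ⁻¹' {Γ.β g}) (Γ.ε (Γ.β g))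
    (X.toFun (Γ.β g))

/-- The right-invariant vector field `g ↦ -(T_{ε(α g)} r_g)((T_{ε(α g)} i)(X(α g)))`, where the
right translation `r_g : h ↦ h g` is defined on the fibre `β⁻¹(α g)` and `i` is the inversion.
Note `i(ε(α g)) = ε(α g)` and `ε(α g) g = g`. -/
def rightInv (Γ : LieGroupoid EM EG M G) (X : Γ.AlgebroidSection) (g : G) :
    TangentSpace 𝓘(ℝ, EG) g :=
  -(mfderivWithin 𝓘(ℝ, EG) 𝓘(ℝ, EG) (fun h => Γ.mul h g) (Γ.β ⁻¹' {Γ.α g}) (Γ.ε (Γ.α g))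
      (mfderiv 𝓘(ℝ, EG) 𝓘(ℝ, EG) Γ.inv (Γ.ε (Γ.α g)) (X.toFun (Γ.α g))) : EG)

/-- The derivative `w(F)` of a function `F` at `g` along a tangent vector `w` at `g`. -/
def dirDeriv (F : G → ℝ) (g : G) (w : TangentSpace 𝓘(ℝ, EG) g) : ℝ :=
  mfderiv 𝓘(ℝ, EG) 𝓘(ℝ, ℝ) F g w

/-- `(g, h)` is a composable pair that solves the discrete Euler–Lagrange equations for `Ld`:
the derivative of `Ld` at `g` along the left-invariant field of `X` equals the derivative of `Ld`
at `h` along the right-invariant field of `X`, for every section `X` of the Lie algebroid. -/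
def IsDELSolution (Γ : LieGroupoid EM EG M G) (Ld : G → ℝ) (g h : G) : Prop :=
  Γ.β g = Γ.α h ∧
    ∀ X : Γ.AlgebroidSection,
      dirDeriv Ld g (Γ.leftInv X g) - dirDeriv Ld h (Γ.rightInv X h) = 0

/-- `W` is a symmetric neighbourhood associated to the open set `U` and the point `x₀`. -/
structure IsSymmetricNhd (Γ : LieGroupoid EM EG M G) (W U : Set G) (x₀ : M) : Prop where
  isOpen : IsOpen W
  subset : W ⊆ U
  ε_mem : Γ.ε x₀ ∈ W
  ε_α_mem : ∀ g ∈ W, Γ.ε (Γ.α g) ∈ W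
  ε_β_mem : ∀ g ∈ W, Γ.ε (Γ.β g) ∈ W
  image_inv : Γ.inv '' W = W
  mul_mem : ∀ g ∈ W, ∀ h ∈ W, Γ.β g = Γ.α h → Γ.mul g h ∈ U

/-- A local bisection: a subset `carrier` of `G` on which `α` and `β` restrict to diffeomorphisms
onto open subsets `U` and `V` of `M`, with inverses `secα` and `secβ` (only the values of `secα`
on `U` and of `secβ` on `V` are constrained or used).  Being the image of a smooth section of the
submersion `α` over an open set, `carrier` is automatically an embedded submanifold of `G`, and a
map into it is smooth if and only if it is smooth as a map into `G`. -/
structure LocalBisection (Γ : LieGroupoid EM EG M G) where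
  /-- the underlying submanifold of `G` -/
  carrier : Set G
  /-- the image of the submanifold under `α` -/
  U : Set M
  /-- the image of the submanifold under `β` -/
  V : Set M
  isOpen_U : IsOpen U
  isOpen_V : IsOpen V
  bijOn_α : Set.BijOn Γ.α carrier U
  bijOn_β : Set.BijOn Γ.β carrier V
  /-- the section of `α` with image `carrier` -/
  secα : M → G
  /-- the section of `β` with image `carrier` -/
  secβ : M → G
  secα_mem : ∀ x ∈ U, secα x ∈ carrier
  secβ_mem : ∀ x ∈ V, secβ x ∈ carrier
  α_secα : ∀ x ∈ U, Γ.α (secα x) = x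
  β_secβ : ∀ x ∈ V, Γ.β (secβ x) = x
  smooth_secα : ContMDiffOn 𝓘(ℝ, EM) 𝓘(ℝ, EG) ∞ secα U
  smooth_secβ : ContMDiffOn 𝓘(ℝ, EM) 𝓘(ℝ, EG) ∞ secβ V

/-- The left translation `L_S(g) = S_β(α g) g`, meaningful on `α⁻¹(V)`. -/
def LocalBisection.leftTrans {Γ : LieGroupoid EM EG M G} (S : Γ.LocalBisection) (g : G) : G :=
  Γ.mul (S.secβ (Γ.α g)) g

/-- The right translation `R_S(g) = g S_α(β g)`, meaningful on `β⁻¹(U)`. -/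
def LocalBisection.rightTrans {Γ : LieGroupoid EM EG M G} (S : Γ.LocalBisection) (g : G) : G :=
  Γ.mul g (S.secα (Γ.β g))

/-- Local coordinates `φ = (x, u)` on an open set `φ.source` of `G` and `ψ = (x)` on an open set
`ψ.source` of `M`, adapted to `α` (so `α` reads `(x, u) ↦ x`), in which the identities in
`φ.source` have coordinates `(x, 0)`. -/
structure AdaptedChart (Γ : LieGroupoid EM EG M G) (n m : ℕ) where
  /-- coordinates on `G` -/
  φ : OpenPartialHomeomorph G ((Fin n → ℝ) × (Fin m → ℝ))
  /-- coordinates on `M` -/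
  ψ : OpenPartialHomeomorph M (Fin n → ℝ)
  smooth_φ : ContMDiffOn 𝓘(ℝ, EG) 𝓘(ℝ, (Fin n → ℝ) × (Fin m → ℝ)) ∞ φ φ.source
  smooth_φ_symm : ContMDiffOn 𝓘(ℝ, (Fin n → ℝ) × (Fin m → ℝ)) 𝓘(ℝ, EG) ∞ φ.symm φ.target
  smooth_ψ : ContMDiffOn 𝓘(ℝ, EM) 𝓘(ℝ, Fin n → ℝ) ∞ ψ ψ.source
  smooth_ψ_symm : ContMDiffOn 𝓘(ℝ, Fin n → ℝ) 𝓘(ℝ, EM) ∞ ψ.symm ψ.target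
  α_mem : ∀ g ∈ φ.source, Γ.α g ∈ ψ.source
  ψ_α : ∀ g ∈ φ.source, ψ (Γ.α g) = (φ g).1
  φ_ε : ∀ x : M, Γ.ε x ∈ φ.source → φ (Γ.ε x) = (ψ x, 0)

/-- The partial derivative `∂f/∂z^j` at `z`. -/
def pderiv {k : ℕ} (f : (Fin k → ℝ) → ℝ) (j : Fin k) (z : Fin k → ℝ) : ℝ :=
  deriv (fun t : ℝ => f (Function.update z j t)) (z j)

namespace AdaptedChart

variable {Γ : LieGroupoid EM EG M G} {n m : ℕ} (c : Γ.AdaptedChart n m)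

/-- `b(x, u)`: the coordinates of `β(g)` when `g` has coordinates `(x, u)`. -/
def b (x : Fin n → ℝ) (u : Fin m → ℝ) : Fin n → ℝ :=
  c.ψ (Γ.β (c.φ.symm (x, u)))

/-- `p(x, u, v)`: the product of the points with coordinates `(x, u)` and `(b(x, u), v)` has
coordinates `(x, p(x, u, v))`. -/
def p (x : Fin n → ℝ) (u v : Fin m → ℝ) : Fin m → ℝ :=
  (c.φ (Γ.mul (c.φ.symm (x, u)) (c.φ.symm (c.b x u, v)))).2

/-- `ρ^i_γ(x) = ∂b^i/∂u^γ (x, 0)`. -/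
def rhoFun (i : Fin n) (γ : Fin m) (x : Fin n → ℝ) : ℝ :=
  pderiv (fun u => c.b x u i) γ 0

/-- `L^γ_μ(x, u) = ∂p^γ/∂v^μ (x, u, 0)`. -/
def LFun (γ μ : Fin m) (x : Fin n → ℝ) (u : Fin m → ℝ) : ℝ :=
  pderiv (fun v => c.p x u v γ) μ 0

/-- `R^γ_μ(x, v) = ∂p^γ/∂u^μ (x, 0, v)`. -/
def RFun (γ μ : Fin m) (x : Fin n → ℝ) (v : Fin m → ℝ) : ℝ :=
  pderiv (fun u => c.p x u v γ) μ 0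

/-- The expression of a function on `G` in the coordinates `(x, u)`. -/
def read (F : G → ℝ) (x : Fin n → ℝ) (u : Fin m → ℝ) : ℝ :=
  F (c.φ.symm (x, u))

end AdaptedChart

end LieGroupoid

end

/-! Bisection translations leave the middle point alone: `β (L_Σ g) = β g` and `α (R_Υ h) = α h`. So
composability of the translated pair is `β g_W = α h_W`, which is `y = b(x, u)` because `ψ` is
injective on its source.

For a composable pair, let `x₁` be the common point. A vector in `A_{x₁} G` is the velocity of a
curve `k(t)` in the α-fibre with coordinates `(y, t w)`. The left-invariant vector is the velocity
of `g k(t)`, the right-invariant one is minus the velocity of `k(t)⁻¹ h`. By associativity both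
products pull back through the bisections: `L_Σ(g_W) k = L_Σ(g_W k)` and `k⁻¹ R_Υ(h_W) = R_Υ(k⁻¹
h_W)`, and the inner products lie in the chart. In coordinates `g_W k(t) = (x, p(x, u, t w))`, which
gives the `L` term (`hasDerivAt_mul_leftTrans`). Also `k(t)⁻¹ h_W = (b(y, t w), q(t))`, where `k
(k⁻¹ h_W) = h_W` reads `p(y, t w, q(t)) = v`. Since `p(y, 0, ·) = id`, differentiating gives `q'(0)
= -R w`, hence the `ρ` and `-R` terms (`hasDerivAt_mul_inv_rightTrans`).

The Euler–Lagrange expression is thus `∑ w^μ E_μ`, depending on the section only through its value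
at `x₁`. Every `w` comes from a global section by a bump-function extension
(`exists_section_hasVelocity_fibreCurve`), so it vanishes for all sections exactly when every `E_μ =
0`. -/

section

open Filter Topology

/-! ### Velocities of curves at time 0. -/

section Velocity

variable {E : Type*} [NormedAddCommGroup E] [NormedSpace ℝ E]
  {E' : Type*} [NormedAddCommGroup E'] [NormedSpace ℝ E']
  {N : Type*} [TopologicalSpace N] [ChartedSpace E N]
  {N' : Type*} [TopologicalSpace N'] [ChartedSpace E' N']

/-- The curve `k` has velocity `w` at time `0`. -/
def HasVelocity (k : ℝ → N) (w : E) : Prop :=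
  HasMFDerivAt 𝓘(ℝ, ℝ) 𝓘(ℝ, E) k 0 (ContinuousLinearMap.toSpanSingleton ℝ w : ℝ →L[ℝ] E)

theorem hasVelocity_iff_hasDerivAt {k : ℝ → E} {w : E} :
    HasVelocity k w ↔ HasDerivAt k w 0 := by
  rw [hasDerivAt_iff_hasFDerivAt]
  exact hasMFDerivAt_iff_hasFDerivAt

theorem hasVelocity_const (a : N) : HasVelocity (fun _ => a) (0 : E) := by
  have h := hasMFDerivAt_const (I := 𝓘(ℝ, ℝ)) (I' := 𝓘(ℝ, E)) a (0 : ℝ)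
  unfold HasVelocity
  rw [ContinuousLinearMap.toSpanSingleton_zero]
  exact h

theorem HasVelocity.congr {k k' : ℝ → N} {w : E} (h : HasVelocity k w) (hk : k' =ᶠ[𝓝 0] k) :
    HasVelocity k' w :=
  HasMFDerivAt.congr_of_eventuallyEq h hk

theorem HasVelocity.unique {k : ℝ → N} {w w' : E} (h : HasVelocity k w) (h' : HasVelocity k w') :
    w = w' := by
  have := DFunLike.congr_fun (hasMFDerivAt_unique h h') (1 : ℝ)
  have h1 : (1 : ℝ) • w = (1 : ℝ) • w' := this
  simpa using h1

theorem HasVelocity.mdifferentiableAt {k : ℝ → N} {w : E} (h : HasVelocity k w) :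
    MDifferentiableAt 𝓘(ℝ, ℝ) 𝓘(ℝ, E) k 0 :=
  HasMFDerivAt.mdifferentiableAt h

/-- A fibre of `α` or `β` need not determine derivatives within it uniquely, so `mfderivWithin`
there may involve a choice. On the velocity of a curve that stays in `s` for all small `t` of both
signs the choice is immaterial: the composite is an honest curve with one velocity. -/
theorem HasVelocity.comp_within {k : ℝ → N} {w : E} (hk : HasVelocity k w) {f : N → N'} {s : Set N}
    {a : N} (ha : k 0 = a) (hf : MDifferentiableWithinAt 𝓘(ℝ, E) 𝓘(ℝ, E') f s a)
    (hs : ∀ᶠ t in 𝓝 (0 : ℝ), k t ∈ s) :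
    HasVelocity (E := E') (fun t => f (k t)) (mfderivWithin 𝓘(ℝ, E) 𝓘(ℝ, E') f s a w) := by
  subst ha
  have h1 := HasMFDerivWithinAt.comp (0 : ℝ) hf.hasMFDerivWithinAt
    (HasMFDerivAt.hasMFDerivWithinAt (s := {t | k t ∈ s}) hk) (fun t ht => ht)
  have h2 := h1.hasMFDerivAt hs
  have h3 : ∀ A : E →L[ℝ] E', A.comp (ContinuousLinearMap.toSpanSingleton ℝ w) =
      ContinuousLinearMap.toSpanSingleton ℝ (A w) := fun A => by ext; simp
  unfold HasVelocity
  exact h3 _ ▸ h2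

theorem HasVelocity.comp {k : ℝ → N} {w : E} (hk : HasVelocity k w) {f : N → N'}
    {a : N} (ha : k 0 = a) (hf : MDifferentiableAt 𝓘(ℝ, E) 𝓘(ℝ, E') f a) :
    HasVelocity (E := E') (fun t => f (k t)) (mfderiv 𝓘(ℝ, E) 𝓘(ℝ, E') f a w) := by
  have := hk.comp_within ha (mdifferentiableWithinAt_univ.2 hf) (Eventually.of_forall fun t => trivial)
  rwa [mfderivWithin_univ] at this

end Velocity

/-! ### Differentials as sums of partial derivatives. -/

section PartialDerivatives

namespace LieGroupoid

theorem pderiv_eq_fderiv {k : ℕ} {f : (Fin k → ℝ) → ℝ} {z : Fin k → ℝ}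
    (hf : DifferentiableAt ℝ f z) (j : Fin k) :
    pderiv f j z = fderiv ℝ f z (Pi.single j 1) := by
  have h : HasDerivAt (fun t : ℝ => f (Function.update z j t))
      (fderiv ℝ f z (Pi.single j 1)) (z j) := by
    refine HasFDerivAt.comp_hasDerivAt (l := f) (z j) ?_ (hasDerivAt_update z j (z j))
    rw [Function.update_eq_self]
    exact hf.hasFDerivAt
  exact h.deriv

theorem fderiv_apply_eq_sum_pderiv {k : ℕ} {f : (Fin k → ℝ) → ℝ} {z : Fin k → ℝ}
    (hf : DifferentiableAt ℝ f z) (w : Fin k → ℝ) :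
    fderiv ℝ f z w = ∑ j, w j * pderiv f j z := by
  conv_lhs => rw [pi_eq_sum_univ' w]
  simp only [map_sum, map_smul, smul_eq_mul, pderiv_eq_fderiv hf]

theorem fderiv_apply_eq_sum_pderiv_pi {k l : ℕ} {f : (Fin k → ℝ) → (Fin l → ℝ)} {z : Fin k → ℝ}
    (hf : DifferentiableAt ℝ f z) (w : Fin k → ℝ) (i : Fin l) :
    fderiv ℝ f z w i = ∑ j, w j * pderiv (fun z' => f z' i) j z := by
  rw [← fderiv_apply_eq_sum_pderiv (differentiableAt_pi.1 hf i) w, fderiv_apply hf i]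
  rfl

theorem hasDerivAt_smul_const_zero {V : Type*} [NormedAddCommGroup V] [NormedSpace ℝ V] (w : V) :
    HasDerivAt (fun t : ℝ => t • w) w 0 := by
  simpa using (hasDerivAt_id (0 : ℝ)).smul_const w

/-- Chain rule for a function of two vector variables along a curve, in terms of the
partial differentials. -/
theorem hasDerivAt_comp_prod {V₁ V₂ V₃ : Type*} [NormedAddCommGroup V₁] [NormedSpace ℝ V₁]
    [NormedAddCommGroup V₂] [NormedSpace ℝ V₂] [NormedAddCommGroup V₃] [NormedSpace ℝ V₃]
    {f : V₁ → V₂ → V₃} {a : V₁} {b : V₂}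
    (hf : DifferentiableAt ℝ (fun z : V₁ × V₂ => f z.1 z.2) (a, b))
    {r : ℝ → V₁} {s : ℝ → V₂} {r' : V₁} {s' : V₂} {t : ℝ} (hr : HasDerivAt r r' t)
    (hs : HasDerivAt s s' t) (hra : r t = a) (hsb : s t = b) :
    HasDerivAt (fun t => f (r t) (s t))
      (fderiv ℝ (fun z => f z b) a r' + fderiv ℝ (f a) b s') t := by
  subst hra hsb
  have h := hf.hasFDerivAt
  have h1 : HasFDerivAt (fun z => f z (s t)) _ (r t) :=
    HasFDerivAt.comp (f := fun z => (z, s t)) (r t) h (hasFDerivAt_prodMk_left _ _)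
  have h2 : HasFDerivAt (f (r t)) _ (s t) :=
    HasFDerivAt.comp (f := fun z => (r t, z)) (s t) h (hasFDerivAt_prodMk_right _ _)
  have h3 := HasFDerivAt.comp_hasDerivAt (f := fun t => (r t, s t)) t h (hr.prodMk hs)
  rw [h1.fderiv, h2.fderiv]
  refine h3.congr_deriv (Eq.symm ?_)
  rw [ContinuousLinearMap.comp_apply, ContinuousLinearMap.comp_apply, ← map_add]
  simp

end LieGroupoid

end PartialDerivatives

/-! ### Products and invariant vector fields along curves. -/

namespace LieGroupoid

variable {EM : Type*} [NormedAddCommGroup EM] [NormedSpace ℝ EM]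
  {EG : Type*} [NormedAddCommGroup EG] [NormedSpace ℝ EG]
  {M : Type*} [TopologicalSpace M] [ChartedSpace EM M]
  {G : Type*} [TopologicalSpace G] [ChartedSpace EG G]

section Basic

variable (Γ : LieGroupoid EM EG M G)

theorem inv_ε (x : M) : Γ.inv (Γ.ε x) = Γ.ε x := by
  have h1 := Γ.ε_mul (Γ.inv (Γ.ε x))
  rw [Γ.α_inv, Γ.β_ε] at h1
  have h2 := Γ.mul_inv (Γ.ε x)
  rw [Γ.α_ε] at h2
  rw [← h1, h2]

theorem mdifferentiable_α : MDifferentiable 𝓘(ℝ, EG) 𝓘(ℝ, EM) Γ.α :=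
  Γ.smooth_α.mdifferentiable (by simp)

theorem mdifferentiable_β : MDifferentiable 𝓘(ℝ, EG) 𝓘(ℝ, EM) Γ.β :=
  Γ.smooth_β.mdifferentiable (by simp)

theorem mdifferentiable_inv : MDifferentiable 𝓘(ℝ, EG) 𝓘(ℝ, EG) Γ.inv :=
  Γ.smooth_inv.mdifferentiable (by simp)

/-- Smoothness of `mul` is known only on composable pairs, so the factors must be composable on all
of `s`. -/
theorem mdifferentiableWithinAt_mul {E : Type*} [NormedAddCommGroup E] [NormedSpace ℝ E]
    {N : Type*} [TopologicalSpace N] [ChartedSpace E N] {f f' : N → G} {s : Set N} {a : N}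
    (hf : MDifferentiableWithinAt 𝓘(ℝ, E) 𝓘(ℝ, EG) f s a)
    (hf' : MDifferentiableWithinAt 𝓘(ℝ, E) 𝓘(ℝ, EG) f' s a) (ha : a ∈ s)
    (hc : ∀ z ∈ s, Γ.β (f z) = Γ.α (f' z)) :
    MDifferentiableWithinAt 𝓘(ℝ, E) 𝓘(ℝ, EG) (fun z => Γ.mul (f z) (f' z)) s a := by
  have h := (Γ.smooth_mul (f a, f' a) (hc a ha)).mdifferentiableWithinAt (by simp)
  exact MDifferentiableWithinAt.comp (f := fun z => (f z, f' z)) a h (hf.prodMk hf') hc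

theorem mdifferentiableAt_mul {E : Type*} [NormedAddCommGroup E] [NormedSpace ℝ E]
    {N : Type*} [TopologicalSpace N] [ChartedSpace E N] {f f' : N → G} {a : N}
    (hf : MDifferentiableAt 𝓘(ℝ, E) 𝓘(ℝ, EG) f a)
    (hf' : MDifferentiableAt 𝓘(ℝ, E) 𝓘(ℝ, EG) f' a)
    (hc : ∀ᶠ z in 𝓝 a, Γ.β (f z) = Γ.α (f' z)) :
    MDifferentiableAt 𝓘(ℝ, E) 𝓘(ℝ, EG) (fun z => Γ.mul (f z) (f' z)) a :=
  (Γ.mdifferentiableWithinAt_mul (s := {z | Γ.β (f z) = Γ.α (f' z)})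
    hf.mdifferentiableWithinAt hf'.mdifferentiableWithinAt hc.self_of_nhds
    fun _ hz => hz).mdifferentiableAt hc

theorem hasVelocity_leftInv [IsManifold 𝓘(ℝ, EM) ∞ M] [IsManifold 𝓘(ℝ, EG) ∞ G]
    (X : Γ.AlgebroidSection) {g : G} {x : M} (hx : Γ.β g = x) {k : ℝ → G}
    (hk : HasVelocity (E := EG) k (X.toFun x)) (h0 : k 0 = Γ.ε x)
    (hα : ∀ᶠ t in 𝓝 (0 : ℝ), Γ.α (k t) = x) :
    HasVelocity (E := EG) (fun t => Γ.mul g (k t)) (Γ.leftInv X g) := by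
  subst hx
  refine hk.comp_within h0 ?_ hα
  exact Γ.mdifferentiableWithinAt_mul mdifferentiableWithinAt_const mdifferentiableWithinAt_id
    (Γ.α_ε _) fun z hz => hz.symm

theorem hasVelocity_rightInv [IsManifold 𝓘(ℝ, EM) ∞ M] [IsManifold 𝓘(ℝ, EG) ∞ G]
    (X : Γ.AlgebroidSection) {g : G} {x : M} (hx : Γ.α g = x) {k : ℝ → G}
    (hk : HasVelocity (E := EG) k (X.toFun x)) (h0 : k 0 = Γ.ε x)
    (hα : ∀ᶠ t in 𝓝 (0 : ℝ), Γ.α (k t) = x) :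
    HasVelocity (E := EG) (fun t => Γ.mul (Γ.inv (k t)) g) (-(Γ.rightInv X g)) := by
  subst hx
  have h1 := hk.comp h0 (Γ.mdifferentiable_inv _)
  have h2 := h1.comp_within (s := Γ.β ⁻¹' {Γ.α g}) (f := fun h => Γ.mul h g)
    (a := Γ.ε (Γ.α g)) (by rw [h0, inv_ε])
    (Γ.mdifferentiableWithinAt_mul mdifferentiableWithinAt_id mdifferentiableWithinAt_const
      (Γ.β_ε _) fun z hz => hz)
    (hα.mono fun t ht => (Γ.β_inv _).trans ht)
  -- The minus sign in `rightInv` cancels, leaving the plain composite of the two tangent maps.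
  have h3 := neg_neg (G := EG) (mfderivWithin 𝓘(ℝ, EG) 𝓘(ℝ, EG) (fun h => Γ.mul h g)
    (Γ.β ⁻¹' {Γ.α g}) (Γ.ε (Γ.α g)) (mfderiv 𝓘(ℝ, EG) 𝓘(ℝ, EG) Γ.inv (Γ.ε (Γ.α g))
      (X.toFun (Γ.α g))))
  exact h3.symm ▸ h2

theorem hasDerivAt_dirDeriv {F : G → ℝ} {g : G} (hF : MDifferentiableAt 𝓘(ℝ, EG) 𝓘(ℝ, ℝ) F g)
    {k : ℝ → G} {w : EG} (hk : HasVelocity k w) (h0 : k 0 = g) :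
    HasDerivAt (fun t => F (k t)) (dirDeriv F g w) 0 :=
  hasVelocity_iff_hasDerivAt.1 (hk.comp h0 hF)

theorem LocalBisection.mdifferentiableAt_leftTrans {Γ : LieGroupoid EM EG M G}
    (S : Γ.LocalBisection) {g : G} (hg : Γ.α g ∈ S.V) :
    MDifferentiableAt 𝓘(ℝ, EG) 𝓘(ℝ, EG) S.leftTrans g := by
  have h1 : MDifferentiableAt 𝓘(ℝ, EM) 𝓘(ℝ, EG) S.secβ (Γ.α g) :=
    ((S.smooth_secβ _ hg).contMDiffAt (S.isOpen_V.mem_nhds hg)).mdifferentiableAt (by simp)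
  refine Γ.mdifferentiableAt_mul (h1.comp g (Γ.mdifferentiable_α g)) mdifferentiableAt_id ?_
  filter_upwards [Γ.smooth_α.continuous.continuousAt.eventually (S.isOpen_V.mem_nhds hg)] with z hz
  exact S.β_secβ _ hz

theorem LocalBisection.mdifferentiableAt_rightTrans {Γ : LieGroupoid EM EG M G}
    (S : Γ.LocalBisection) {g : G} (hg : Γ.β g ∈ S.U) :
    MDifferentiableAt 𝓘(ℝ, EG) 𝓘(ℝ, EG) S.rightTrans g := by
  have h1 : MDifferentiableAt 𝓘(ℝ, EM) 𝓘(ℝ, EG) S.secα (Γ.β g) :=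
    ((S.smooth_secα _ hg).contMDiffAt (S.isOpen_U.mem_nhds hg)).mdifferentiableAt (by simp)
  refine Γ.mdifferentiableAt_mul mdifferentiableAt_id (h1.comp g (Γ.mdifferentiable_β g)) ?_
  filter_upwards [Γ.smooth_β.continuous.continuousAt.eventually (S.isOpen_U.mem_nhds hg)] with z hz
  exact (S.α_secα _ hz).symm

end Basic

/-! ### Straight lines in the α-fibre as representatives of algebroid vectors. -/

namespace AdaptedChart

variable {Γ : LieGroupoid EM EG M G} {n m : ℕ} (c : Γ.AdaptedChart n m)

theorem mdifferentiableAt_φ {g : G} (hg : g ∈ c.φ.source) :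
    MDifferentiableAt 𝓘(ℝ, EG) 𝓘(ℝ, (Fin n → ℝ) × (Fin m → ℝ)) c.φ g :=
  (c.smooth_φ.contMDiffAt (c.φ.open_source.mem_nhds hg)).mdifferentiableAt (by simp)

theorem mdifferentiableAt_φ_symm {z : (Fin n → ℝ) × (Fin m → ℝ)} (hz : z ∈ c.φ.target) :
    MDifferentiableAt 𝓘(ℝ, (Fin n → ℝ) × (Fin m → ℝ)) 𝓘(ℝ, EG) c.φ.symm z :=
  (c.smooth_φ_symm.contMDiffAt (c.φ.open_target.mem_nhds hz)).mdifferentiableAt (by simp)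

theorem mdifferentiableAt_ψ {x : M} (hx : x ∈ c.ψ.source) :
    MDifferentiableAt 𝓘(ℝ, EM) 𝓘(ℝ, Fin n → ℝ) c.ψ x :=
  (c.smooth_ψ.contMDiffAt (c.ψ.open_source.mem_nhds hx)).mdifferentiableAt (by simp)

theorem α_φ_symm {z : (Fin n → ℝ) × (Fin m → ℝ)} (hz : z ∈ c.φ.target) :
    Γ.α (c.φ.symm z) = c.ψ.symm z.1 := by
  have h := c.φ.map_target hz
  rw [← c.ψ.left_inv (c.α_mem _ h), c.ψ_α _ h, c.φ.right_inv hz]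

theorem mem_ψ_source {x : M} (hx : Γ.ε x ∈ c.φ.source) : x ∈ c.ψ.source := by
  simpa only [Γ.α_ε] using c.α_mem _ hx

theorem mem_φ_target {x : M} (hx : Γ.ε x ∈ c.φ.source) : (c.ψ x, 0) ∈ c.φ.target := by
  rw [← c.φ_ε x hx]
  exact c.φ.map_source hx

theorem φ_symm_ε {x : M} (hx : Γ.ε x ∈ c.φ.source) : c.φ.symm (c.ψ x, 0) = Γ.ε x := by
  rw [← c.φ_ε x hx, c.φ.left_inv hx]

/-- The straight line through the identity with coordinates `(y, 0)` in the direction `(0, w)`. -/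
def fibreCurve (y : Fin n → ℝ) (w : Fin m → ℝ) (t : ℝ) : G :=
  c.φ.symm (y, t • w)

theorem fibreCurve_zero {x : M} (hx : Γ.ε x ∈ c.φ.source) (w : Fin m → ℝ) :
    c.fibreCurve (c.ψ x) w 0 = Γ.ε x := by
  rw [fibreCurve, zero_smul, c.φ_symm_ε hx]

theorem eventually_mem_target {x : M} (hx : Γ.ε x ∈ c.φ.source) (w : Fin m → ℝ) :
    ∀ᶠ t in 𝓝 (0 : ℝ), (c.ψ x, t • w) ∈ c.φ.target := by
  have h : ContinuousAt (fun t : ℝ => (c.ψ x, t • w)) 0 := by fun_prop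
  refine h.eventually (c.φ.open_target.mem_nhds ?_)
  simp only [zero_smul]
  exact c.mem_φ_target hx

theorem α_fibreCurve {x : M} (hx : Γ.ε x ∈ c.φ.source) (w : Fin m → ℝ) :
    ∀ᶠ t in 𝓝 (0 : ℝ), Γ.α (c.fibreCurve (c.ψ x) w t) = x := by
  filter_upwards [c.eventually_mem_target hx w] with t ht
  rw [fibreCurve, c.α_φ_symm ht, c.ψ.left_inv (c.mem_ψ_source hx)]

theorem hasVelocity_fibreCurve {x : M} (hx : Γ.ε x ∈ c.φ.source) (w : Fin m → ℝ) :
    HasVelocity (E := EG) (c.fibreCurve (c.ψ x) w)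
      (mfderiv 𝓘(ℝ, (Fin n → ℝ) × (Fin m → ℝ)) 𝓘(ℝ, EG) c.φ.symm (c.ψ x, 0) (0, w)) := by
  have h : HasVelocity (fun t : ℝ => (c.ψ x, t • w)) ((0, w) : (Fin n → ℝ) × (Fin m → ℝ)) := by
    rw [hasVelocity_iff_hasDerivAt]
    refine (hasDerivAt_const _ _).prodMk ?_
    exact hasDerivAt_smul_const_zero w
  exact h.comp (by rw [zero_smul]) (c.mdifferentiableAt_φ_symm (c.mem_φ_target hx))

/-- Since `ψ ∘ α` is the first component of `φ`, a vector killed by `Tα` has `Tφ`-image `(0, w)`;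
applying the inverse of `Tφ` recovers the vector as the velocity of the line in direction `w`. -/
theorem exists_hasVelocity_fibreCurve {x : M} (hx : Γ.ε x ∈ c.φ.source)
    {X : TangentSpace 𝓘(ℝ, EG) (Γ.ε x)}
    (hX : mfderiv 𝓘(ℝ, EG) 𝓘(ℝ, EM) Γ.α (Γ.ε x) X = 0) :
    ∃ w : Fin m → ℝ, HasVelocity (E := EG) (c.fibreCurve (c.ψ x) w) X := by
  have hφ := c.mdifferentiableAt_φ hx
  have hs := c.mdifferentiableAt_φ_symm (c.φ.map_source hx)
  set T := mfderiv 𝓘(ℝ, EG) 𝓘(ℝ, (Fin n → ℝ) × (Fin m → ℝ)) c.φ (Γ.ε x) with hT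
  have h1 : mfderiv 𝓘(ℝ, (Fin n → ℝ) × (Fin m → ℝ)) 𝓘(ℝ, EG) c.φ.symm (c.φ (Γ.ε x)) (T X) = X := by
    have e : c.φ.symm ∘ c.φ =ᶠ[𝓝 (Γ.ε x)] id := by
      filter_upwards [c.φ.open_source.mem_nhds hx] with z hz using c.φ.left_inv hz
    have h := HasMFDerivAt.comp _ hs.hasMFDerivAt hφ.hasMFDerivAt
    have h' := hasMFDerivAt_unique (h.congr_of_eventuallyEq e.symm) (hasMFDerivAt_id _)
    exact DFunLike.congr_fun h' X
  have h2 : (T X : (Fin n → ℝ) × (Fin m → ℝ)).1 = 0 := by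
    have e : (fun g => (c.φ g).1) =ᶠ[𝓝 (Γ.ε x)] c.ψ ∘ Γ.α := by
      filter_upwards [c.φ.open_source.mem_nhds hx] with z hz using (c.ψ_α z hz).symm
    have hf := HasMFDerivAt.comp (g := Prod.fst) (Γ.ε x)
      (hasMFDerivAt_iff_hasFDerivAt.2 (hasFDerivAt_fst (𝕜 := ℝ) (p := c.φ (Γ.ε x)))) hφ.hasMFDerivAt
    have hψ := HasMFDerivAt.comp (Γ.ε x) (c.mdifferentiableAt_ψ (c.α_mem _ hx)).hasMFDerivAt
      (Γ.mdifferentiable_α (Γ.ε x)).hasMFDerivAt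
    have h' := DFunLike.congr_fun
      (hasMFDerivAt_unique (hψ.congr_of_eventuallyEq e) hf) X
    refine h'.symm.trans ?_
    change mfderiv 𝓘(ℝ, EM) 𝓘(ℝ, Fin n → ℝ) c.ψ (Γ.α (Γ.ε x))
      (mfderiv 𝓘(ℝ, EG) 𝓘(ℝ, EM) Γ.α (Γ.ε x) X) = 0
    rw [hX, map_zero]
  refine ⟨(T X : (Fin n → ℝ) × (Fin m → ℝ)).2, ?_⟩
  have h3 := c.hasVelocity_fibreCurve hx (T X : (Fin n → ℝ) × (Fin m → ℝ)).2
  have h4 : ((0, (T X : (Fin n → ℝ) × (Fin m → ℝ)).2) : (Fin n → ℝ) × (Fin m → ℝ)) = T X :=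
    Prod.ext h2.symm rfl
  rw [h4, ← c.φ_ε x hx] at h3
  rwa [h1] at h3

theorem vertical_of_hasVelocity_fibreCurve {x : M} (hx : Γ.ε x ∈ c.φ.source) {w : Fin m → ℝ}
    {X : TangentSpace 𝓘(ℝ, EG) (Γ.ε x)} (hX : HasVelocity (E := EG) (c.fibreCurve (c.ψ x) w) X) :
    mfderiv 𝓘(ℝ, EG) 𝓘(ℝ, EM) Γ.α (Γ.ε x) X = 0 :=
  (hX.comp (c.fibreCurve_zero hx w) (Γ.mdifferentiable_α _)).unique
    ((hasVelocity_const x).congr (c.α_fibreCurve hx w))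

end AdaptedChart

end LieGroupoid

/-! ### Global sections with a prescribed value at a point. -/

namespace LieGroupoid

theorem contMDiffAt_tangentBundle_mk {E : Type*} [NormedAddCommGroup E] [NormedSpace ℝ E]
    {N : Type*} [TopologicalSpace N] [ChartedSpace E N]
    {V : Type*} [NormedAddCommGroup V] [NormedSpace ℝ V] {f f' : N → V} {x : N}
    (hf : ContMDiffAt 𝓘(ℝ, E) 𝓘(ℝ, V) ∞ f x) (hf' : ContMDiffAt 𝓘(ℝ, E) 𝓘(ℝ, V) ∞ f' x) :
    ContMDiffAt 𝓘(ℝ, E) 𝓘(ℝ, V).tangent ∞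
      (fun z => (⟨f z, f' z⟩ : TangentBundle 𝓘(ℝ, V) V)) x := by
  refine Bundle.contMDiffAt_totalSpace.2 ⟨hf, ?_⟩
  simpa only [trivializationAt_model_space_apply] using hf'

namespace AdaptedChart

variable {EM : Type*} [NormedAddCommGroup EM] [NormedSpace ℝ EM]
  {EG : Type*} [NormedAddCommGroup EG] [NormedSpace ℝ EG]
  {M : Type*} [TopologicalSpace M] [ChartedSpace EM M]
  {G : Type*} [TopologicalSpace G] [ChartedSpace EG G]
  {Γ : LieGroupoid EM EG M G} {n m : ℕ} (c : Γ.AdaptedChart n m)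

/-- The constant field `(0, w)` along the identities, cut off by a bump function supported where the
identities lie in the chart, extends by zero to all of `M`. -/
theorem exists_section_hasVelocity_fibreCurve [FiniteDimensional ℝ EM] [T2Space M]
    [IsManifold 𝓘(ℝ, EM) ∞ M] [IsManifold 𝓘(ℝ, EG) ∞ G]
    {x₁ : M} (hx₁ : Γ.ε x₁ ∈ c.φ.source) (w : Fin m → ℝ) :
    ∃ X : Γ.AlgebroidSection, HasVelocity (E := EG) (c.fibreCurve (c.ψ x₁) w) (X.toFun x₁) := by
  have hN : IsOpen {x | Γ.ε x ∈ c.φ.source} :=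
    c.φ.open_source.preimage Γ.smooth_ε.continuous
  obtain ⟨f, -, hf⟩ := (SmoothBumpFunction.nhds_basis_tsupport (I := 𝓘(ℝ, EM)) x₁).mem_iff.1
    (hN.mem_nhds hx₁)
  let V := (Fin n → ℝ) × (Fin m → ℝ)
  -- Outside the chart `c.φ.symm` and `c.ψ` carry no information, but `f` vanishes there and
  -- linearity makes `X` zero.
  let X : M → EG := fun x => mfderiv 𝓘(ℝ, V) 𝓘(ℝ, EG) c.φ.symm (c.ψ x, 0) (0, f x • w)
  have hX0 : ∀ x, f x = 0 → X x = 0 := by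
    intro x hx
    have h : ((0, f x • w) : V) = 0 := by rw [hx, zero_smul]; rfl
    exact (congrArg (mfderiv 𝓘(ℝ, V) 𝓘(ℝ, EG) c.φ.symm (c.ψ x, 0)) h).trans (map_zero _)
  have hXv : ∀ x, Γ.ε x ∈ c.φ.source →
      HasVelocity (E := EG) (c.fibreCurve (c.ψ x) (f x • w)) (X x) :=
    fun x hx => c.hasVelocity_fibreCurve hx _
  refine ⟨⟨X, fun x => ?_, fun x => ?_⟩, ?_⟩
  · by_cases hx : x ∈ tsupport f
    · exact c.vertical_of_hasVelocity_fibreCurve (hf hx) (hXv x (hf hx))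
    · rw [hX0 x (image_eq_zero_of_notMem_tsupport hx)]
      exact map_zero _
  · by_cases hx : x ∈ tsupport f
    · have hεx : Γ.ε x ∈ c.φ.source := hf hx
      have hψ : ContMDiffAt 𝓘(ℝ, EM) 𝓘(ℝ, Fin n → ℝ) ∞ c.ψ x :=
        c.smooth_ψ.contMDiffAt (c.ψ.open_source.mem_nhds (c.mem_ψ_source hεx))
      have h1 : ContMDiffAt 𝓘(ℝ, EM) 𝓘(ℝ, V) ∞ (fun x => (c.ψ x, (0 : Fin m → ℝ))) x :=
        hψ.prodMk_space contMDiffAt_const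
      have h2 : ContMDiffAt 𝓘(ℝ, EM) 𝓘(ℝ, V) ∞ (fun x => ((0 : Fin n → ℝ), f x • w)) x :=
        contMDiffAt_const.prodMk_space ((f.contMDiff x).smul contMDiffAt_const)
      have h3 := contMDiffAt_tangentBundle_mk h1 h2
      -- Near `x` the section is the tangent map of `c.φ.symm` applied to the smooth map `z ↦ ((ψ z,
      -- 0), (0, f z • w))`.
      have h4 := c.smooth_φ_symm.contMDiffOn_tangentMapWithin (m := ∞) (by simp)
        c.φ.open_target.uniqueMDiffOn
      have ht : (c.ψ x, (0 : Fin m → ℝ)) ∈ c.φ.target := c.mem_φ_target hεx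
      have h5 := (h4.contMDiffAt (x := (⟨(c.ψ x, 0), (0, f x • w)⟩ : TangentBundle 𝓘(ℝ, V) V))
        ((c.φ.open_target.preimage (FiberBundle.continuous_proj _ _)).mem_nhds ht))
      have h6 := ContMDiffAt.comp x h5 h3
      refine h6.congr_of_eventuallyEq ?_
      filter_upwards [hN.mem_nhds hεx] with z hz
      have hzt := c.mem_φ_target hz
      simp only [Function.comp_apply, tangentMapWithin]
      rw [mfderivWithin_of_mem_nhds (c.φ.open_target.mem_nhds hzt)]
      refine Bundle.TotalSpace.ext (c.φ_symm_ε hz).symm ?_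
      exact HEq.rfl
    -- Off the support, `X` agrees near `x` with the zero section along `ε`.
    · have h1 : ContMDiffAt 𝓘(ℝ, EM) 𝓘(ℝ, EG).tangent ∞
          (fun x => (⟨Γ.ε x, 0⟩ : TangentBundle 𝓘(ℝ, EG) G)) x :=
        ((Bundle.contMDiff_zeroSection ℝ (TangentSpace 𝓘(ℝ, EG) (M := G))).comp Γ.smooth_ε) x
      refine h1.congr_of_eventuallyEq ?_
      filter_upwards [(isClosed_tsupport f).isOpen_compl.mem_nhds hx] with z hz
      rw [hX0 z (image_eq_zero_of_notMem_tsupport hz)]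
      rfl
  · have h := hXv x₁ hx₁
    rwa [f.eq_one, one_smul] at h

end AdaptedChart

end LieGroupoid

/-! ### Bisection translations and derivatives in coordinates. -/

namespace LieGroupoid

variable {EM : Type*} [NormedAddCommGroup EM] [NormedSpace ℝ EM]
  {EG : Type*} [NormedAddCommGroup EG] [NormedSpace ℝ EG]
  {M : Type*} [TopologicalSpace M] [ChartedSpace EM M]
  {G : Type*} [TopologicalSpace G] [ChartedSpace EG G]
  {Γ : LieGroupoid EM EG M G} {n m : ℕ}

theorem IsSymmetricNhd.inv_mem {W U : Set G} {x₀ : M} (h : Γ.IsSymmetricNhd W U x₀) {g : G}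
    (hg : g ∈ W) : Γ.inv g ∈ W :=
  h.image_inv ▸ Set.mem_image_of_mem _ hg

theorem IsSymmetricNhd.β_mem_image_α {W U : Set G} {x₀ : M} (h : Γ.IsSymmetricNhd W U x₀) {g : G}
    (hg : g ∈ W) : Γ.β g ∈ Γ.α '' W :=
  ⟨Γ.inv g, h.inv_mem hg, Γ.α_inv g⟩

theorem LocalBisection.β_leftTrans (S : Γ.LocalBisection) {g : G} (hg : Γ.α g ∈ S.V) :
    Γ.β (S.leftTrans g) = Γ.β g :=
  Γ.β_mul _ _ (S.β_secβ _ hg)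

theorem LocalBisection.α_rightTrans (S : Γ.LocalBisection) {g : G} (hg : Γ.β g ∈ S.U) :
    Γ.α (S.rightTrans g) = Γ.α g :=
  Γ.α_mul _ _ (S.α_secα _ hg).symm

theorem LocalBisection.mul_leftTrans (S : Γ.LocalBisection) {g k : G} (hg : Γ.α g ∈ S.V)
    (hk : Γ.β g = Γ.α k) : Γ.mul (S.leftTrans g) k = S.leftTrans (Γ.mul g k) := by
  rw [leftTrans, leftTrans, Γ.α_mul _ _ hk, Γ.mul_assoc _ _ _ (S.β_secβ _ hg) hk]

theorem LocalBisection.mul_rightTrans (S : Γ.LocalBisection) {g k : G} (hg : Γ.β g ∈ S.U)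
    (hk : Γ.β k = Γ.α g) : Γ.mul k (S.rightTrans g) = S.rightTrans (Γ.mul k g) := by
  rw [rightTrans, rightTrans, Γ.β_mul _ _ hk, Γ.mul_assoc _ _ _ hk (S.α_secα _ hg).symm]

namespace AdaptedChart

variable (c : Γ.AdaptedChart n m)

theorem differentiableAt_b {y : Fin n → ℝ} {u : Fin m → ℝ} (hu : (y, u) ∈ c.φ.target)
    (hβ : Γ.β (c.φ.symm (y, u)) ∈ c.ψ.source) : DifferentiableAt ℝ (c.b y) u := by
  have h1 : MDifferentiableAt 𝓘(ℝ, Fin m → ℝ) 𝓘(ℝ, (Fin n → ℝ) × (Fin m → ℝ))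
      (fun u' => (y, u')) u :=
    DifferentiableAt.mdifferentiableAt (by fun_prop)
  have h2 := MDifferentiableAt.comp u (c.mdifferentiableAt_φ_symm hu) h1
  have h3 := MDifferentiableAt.comp u (Γ.mdifferentiable_β _) h2
  exact (MDifferentiableAt.comp u (c.mdifferentiableAt_ψ hβ) h3).differentiableAt

theorem differentiableAt_p {y : Fin n → ℝ} {u v : Fin m → ℝ} (hu : (y, u) ∈ c.φ.target)
    (hβ : Γ.β (c.φ.symm (y, u)) ∈ c.ψ.source) (hv : (c.b y u, v) ∈ c.φ.target)
    (hm : Γ.mul (c.φ.symm (y, u)) (c.φ.symm (c.b y u, v)) ∈ c.φ.source) :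
    DifferentiableAt ℝ (fun z : (Fin m → ℝ) × (Fin m → ℝ) => c.p y z.1 z.2) (u, v) := by
  have h1 : MDifferentiableAt 𝓘(ℝ, (Fin m → ℝ) × (Fin m → ℝ))
      𝓘(ℝ, (Fin n → ℝ) × (Fin m → ℝ))
      (fun z : (Fin m → ℝ) × (Fin m → ℝ) => (y, z.1)) (u, v) :=
    DifferentiableAt.mdifferentiableAt (by fun_prop)
  have h2 : MDifferentiableAt 𝓘(ℝ, (Fin m → ℝ) × (Fin m → ℝ))
      𝓘(ℝ, (Fin n → ℝ) × (Fin m → ℝ))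
      (fun z : (Fin m → ℝ) × (Fin m → ℝ) => (c.b y z.1, z.2)) (u, v) :=
    DifferentiableAt.mdifferentiableAt
      ((DifferentiableAt.comp (f := Prod.fst) (u, v) (c.differentiableAt_b hu hβ)
        differentiableAt_fst).prodMk differentiableAt_snd)
  have h1' := MDifferentiableAt.comp (u, v) (c.mdifferentiableAt_φ_symm hu) h1
  have h2' := MDifferentiableAt.comp (u, v) (c.mdifferentiableAt_φ_symm hv) h2
  have hβ' := MDifferentiableAt.comp (u, v) (Γ.mdifferentiable_β _) h1'
  -- Composability holds only near `(u, v)`: recovering `β` from its coordinates `b` requires `β` to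
  -- stay in `c.ψ.source`.
  have h3 := Γ.mdifferentiableAt_mul h1' h2' (by
    filter_upwards [h1.continuousAt.eventually (c.φ.open_target.mem_nhds hu),
      h2.continuousAt.eventually (c.φ.open_target.mem_nhds hv),
      hβ'.continuousAt.eventually (c.ψ.open_source.mem_nhds hβ)] with z hz1 hz2 hz3
    rw [Function.comp_apply, Function.comp_apply, c.α_φ_symm hz2]
    exact (c.ψ.left_inv hz3).symm)
  exact (MDifferentiableAt.comp (u, v) (c.mdifferentiableAt_φ hm) h3).differentiableAt.snd

theorem differentiableAt_read {F : G → ℝ} {g : G} {x : Fin n → ℝ} {u : Fin m → ℝ}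
    (hF : MDifferentiableAt 𝓘(ℝ, EG) 𝓘(ℝ, ℝ) F g) (hg : g ∈ c.φ.source) (hxu : c.φ g = (x, u)) :
    DifferentiableAt ℝ (fun z : (Fin n → ℝ) × (Fin m → ℝ) => c.read F z.1 z.2) (x, u) := by
  have hg' : g = c.φ.symm (x, u) := by rw [← hxu, c.φ.left_inv hg]
  rw [hg'] at hF
  exact (MDifferentiableAt.comp (x, u) hF
    (c.mdifferentiableAt_φ_symm (hxu ▸ c.φ.map_source hg))).differentiableAt

theorem eventually_fibreCurve_mem {W : Set G} (hW : IsOpen W) (hWs : W ⊆ c.φ.source) {x : M}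
    (hx : Γ.ε x ∈ W) (w : Fin m → ℝ) : ∀ᶠ t in 𝓝 (0 : ℝ), c.fibreCurve (c.ψ x) w t ∈ W := by
  refine (c.hasVelocity_fibreCurve (hWs hx) w).mdifferentiableAt.continuousAt.eventually
    (hW.mem_nhds ?_)
  rwa [c.fibreCurve_zero (hWs hx)]

/-- Right multiplication by `k(t)` fixes the source, so only the `u`-coordinates `p(x, u, t w)` of
`g k(t)` move, starting at `u`; the chain rule gives the sum. -/
theorem hasDerivAt_mul_leftTrans {W : Set G} {x₀ : M}
    (hsymm : Γ.IsSymmetricNhd W c.φ.source x₀) {Ld : G → ℝ}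
    (hLd : MDifferentiable 𝓘(ℝ, EG) 𝓘(ℝ, ℝ) Ld) (S : Γ.LocalBisection) (hS : Γ.α '' W ⊆ S.V)
    {g : G} (hg : g ∈ W) {x : Fin n → ℝ} {u : Fin m → ℝ} (hxu : c.φ g = (x, u)) {x₁ : M}
    (hx₁ : Γ.β g = x₁) (w : Fin m → ℝ) :
    HasDerivAt (fun t => Ld (Γ.mul (S.leftTrans g) (c.fibreCurve (c.ψ x₁) w t)))
      (∑ μ, w μ * ∑ γ, c.LFun γ μ x u *
        pderiv (fun u' => c.read (Ld ∘ S.leftTrans) x u') γ u) 0 := by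
  have hgs := hsymm.subset hg
  have hgV : Γ.α g ∈ S.V := hS ⟨g, hg, rfl⟩
  have hxg : c.φ.symm (x, u) = g := by rw [← hxu, c.φ.left_inv hgs]
  have hxt : (x, u) ∈ c.φ.target := hxu ▸ c.φ.map_source hgs
  have hεW : Γ.ε x₁ ∈ W := hx₁ ▸ hsymm.ε_β_mem g hg
  have hεs := hsymm.subset hεW
  have hb : c.b x u = c.ψ x₁ := by rw [b, hxg, hx₁]
  have hmul0 : Γ.mul g (c.φ.symm (c.ψ x₁, 0)) = g := by
    rw [c.φ_symm_ε hεs, ← hx₁, Γ.mul_ε]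
  have hp0 : c.p x u 0 = u := by rw [p, hxg, hb, hmul0, hxu]
  have hp : DifferentiableAt ℝ (c.p x u) 0 := by
    have h := c.differentiableAt_p (v := 0) hxt (by rw [hxg, hx₁]; exact c.mem_ψ_source hεs)
      (by rw [hb]; exact c.mem_φ_target hεs) (by rw [hxg, hb, hmul0]; exact hgs)
    exact DifferentiableAt.comp (f := fun v : Fin m → ℝ => (u, v)) 0 h (by fun_prop)
  have hread : DifferentiableAt ℝ (c.read (Ld ∘ S.leftTrans) x) u :=
    DifferentiableAt.comp (f := fun v : Fin m → ℝ => (x, v)) u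
      (c.differentiableAt_read ((hLd _).comp g (S.mdifferentiableAt_leftTrans hgV)) hgs hxu)
      (by fun_prop)
  have hpt : HasDerivAt (fun t : ℝ => c.p x u (t • w)) (fderiv ℝ (c.p x u) 0 w) 0 :=
    HasFDerivAt.comp_hasDerivAt (l := c.p x u) 0 (by simpa using hp.hasFDerivAt)
      (hasDerivAt_smul_const_zero w)
  have hF : HasDerivAt (fun t : ℝ => c.read (Ld ∘ S.leftTrans) x (c.p x u (t • w)))
      (fderiv ℝ (c.read (Ld ∘ S.leftTrans) x) u (fderiv ℝ (c.p x u) 0 w)) 0 :=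
    HasFDerivAt.comp_hasDerivAt (l := c.read (Ld ∘ S.leftTrans) x) 0
      (by simpa [hp0] using hread.hasFDerivAt) hpt
  have hE : (fun t => Ld (Γ.mul (S.leftTrans g) (c.fibreCurve (c.ψ x₁) w t))) =ᶠ[𝓝 0]
      fun t : ℝ => c.read (Ld ∘ S.leftTrans) x (c.p x u (t • w)) := by
    filter_upwards [c.α_fibreCurve hεs w,
      c.eventually_fibreCurve_mem hsymm.isOpen hsymm.subset hεW w] with t htα htW
    have hc : Γ.β g = Γ.α (c.fibreCurve (c.ψ x₁) w t) := hx₁.trans htα.symm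
    -- The curve must lie in `W`, not merely in the chart, for the product to have coordinates.
    have hms := hsymm.mul_mem _ hg _ htW hc
    have h1 : c.φ (Γ.mul g (c.fibreCurve (c.ψ x₁) w t)) = (x, c.p x u (t • w)) := by
      refine Prod.ext ?_ ?_
      · rw [← c.ψ_α _ hms, Γ.α_mul _ _ hc, c.ψ_α _ hgs, hxu]
      · rw [p, hxg, hb, fibreCurve]
    rw [S.mul_leftTrans hgV hc, read, ← h1, c.φ.left_inv hms, Function.comp_apply]
  refine (hF.congr_of_eventuallyEq hE).congr_deriv ?_
  rw [fderiv_apply_eq_sum_pderiv hread]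
  simp only [fderiv_apply_eq_sum_pderiv_pi hp, Finset.sum_mul, Finset.mul_sum]
  rw [Finset.sum_comm]
  exact Finset.sum_congr rfl fun μ _ => Finset.sum_congr rfl fun γ _ => _root_.mul_assoc _ _ _

theorem b_zero {x : M} (hx : Γ.ε x ∈ c.φ.source) : c.b (c.ψ x) 0 = c.ψ x := by
  rw [b, c.φ_symm_ε hx, Γ.β_ε]

theorem p_zero_left {x : M} (hx : Γ.ε x ∈ c.φ.source) {v : Fin m → ℝ}
    (hv : (c.ψ x, v) ∈ c.φ.target) : c.p (c.ψ x) 0 v = v := by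
  have hα : Γ.α (c.φ.symm (c.ψ x, v)) = x := by
    rw [c.α_φ_symm hv, c.ψ.left_inv (c.mem_ψ_source hx)]
  have h := Γ.ε_mul (c.φ.symm (c.ψ x, v))
  rw [hα] at h
  rw [p, c.b_zero hx, c.φ_symm_ε hx, h, c.φ.right_inv hv]

/-- The source of `k(t)⁻¹ h` is `β (k t)`, with coordinates `b(y, t w)`; this yields `ρ`. The
remaining coordinates `q` are found implicitly, so inversion is never differentiated in coordinates.
-/
theorem hasDerivAt_mul_inv_rightTrans {W : Set G} {x₀ : M}
    (hsymm : Γ.IsSymmetricNhd W c.φ.source x₀) {Ld : G → ℝ}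
    (hLd : MDifferentiable 𝓘(ℝ, EG) 𝓘(ℝ, ℝ) Ld) (S : Γ.LocalBisection) (hS : Γ.α '' W ⊆ S.U)
    {h : G} (hh : h ∈ W) {y : Fin n → ℝ} {v : Fin m → ℝ} (hyv : c.φ h = (y, v)) {x₁ : M}
    (hx₁ : Γ.α h = x₁) (w : Fin m → ℝ) :
    HasDerivAt (fun t => Ld (Γ.mul (Γ.inv (c.fibreCurve (c.ψ x₁) w t)) (S.rightTrans h)))
      (∑ μ, w μ * (∑ i, c.rhoFun i μ y *
          pderiv (fun y' => c.read (Ld ∘ S.rightTrans) y' v) i y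
        - ∑ γ, c.RFun γ μ y v *
          pderiv (fun v' => c.read (Ld ∘ S.rightTrans) y v') γ v)) 0 := by
  have hhs := hsymm.subset hh
  have hhU : Γ.β h ∈ S.U := hS (hsymm.β_mem_image_α hh)
  have hεW : Γ.ε x₁ ∈ W := hx₁ ▸ hsymm.ε_α_mem h hh
  have hεs := hsymm.subset hεW
  have hy : c.ψ x₁ = y := by rw [← hx₁, c.ψ_α h hhs, hyv]
  have hyt : (y, v) ∈ c.φ.target := hyv ▸ c.φ.map_source hhs
  have hy0 : c.φ.symm (y, 0) = Γ.ε x₁ := by rw [← hy, c.φ_symm_ε hεs]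
  have hb0 : c.b y 0 = y := hy ▸ c.b_zero hεs
  have hεh : Γ.mul (Γ.ε x₁) h = h := by rw [← hx₁, Γ.ε_mul]
  have hy0t : (y, (0 : Fin m → ℝ)) ∈ c.φ.target := hy ▸ c.mem_φ_target hεs
  have hβ0 : Γ.β (c.φ.symm (y, 0)) ∈ c.ψ.source := by
    rw [hy0, Γ.β_ε]
    exact c.mem_ψ_source hεs
  have hb := c.differentiableAt_b hy0t hβ0
  have hp := c.differentiableAt_p hy0t hβ0 (v := v) (by rwa [hb0])
    (by rwa [hb0, hy0, ← hyv, c.φ.left_inv hhs, hεh])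
  set k := c.fibreCurve (c.ψ x₁) w with hk
  have hk0 : k 0 = Γ.ε x₁ := c.fibreCurve_zero hεs w
  set q : ℝ → (Fin m → ℝ) := fun t => (c.φ (Γ.mul (Γ.inv (k t)) h)).2 with hq
  have hinv0 : Γ.mul (Γ.inv (k 0)) h = h := by rw [hk0, inv_ε, hεh]
  have hq0 : q 0 = v := by simp only [hq]; rw [hinv0, hyv]
  -- Differentiability of `q` comes from smoothness of inversion and product, so no implicit
  -- function theorem is needed.
  have hqd : DifferentiableAt ℝ q 0 := by
    have h1 := MDifferentiableAt.comp (0 : ℝ) (Γ.mdifferentiable_inv _)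
      (c.hasVelocity_fibreCurve hεs w).mdifferentiableAt
    have h2 := Γ.mdifferentiableAt_mul h1 (mdifferentiableAt_const (c := h)) (by
      filter_upwards [c.α_fibreCurve hεs w] with t ht
      rw [Function.comp_apply, Γ.β_inv, ht, hx₁])
    have h3 : Γ.mul (Γ.inv (k 0)) h ∈ c.φ.source := by rwa [hinv0]
    exact (MDifferentiableAt.comp (0 : ℝ) (c.mdifferentiableAt_φ h3) h2).differentiableAt.snd
  have hcurve : ∀ᶠ t in 𝓝 (0 : ℝ), Γ.α (k t) = x₁ ∧ Γ.β (Γ.inv (k t)) = Γ.α h ∧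
      Γ.mul (Γ.inv (k t)) h = c.φ.symm (c.b y (t • w), q t) := by
    filter_upwards [c.α_fibreCurve hεs w,
      c.eventually_fibreCurve_mem hsymm.isOpen hsymm.subset hεW w] with t htα htW
    have hc : Γ.β (Γ.inv (k t)) = Γ.α h := by rw [Γ.β_inv, htα, hx₁]
    have hms := hsymm.mul_mem _ (hsymm.inv_mem htW) _ hh hc
    refine ⟨htα, hc, ?_⟩
    have h1 : c.φ (Γ.mul (Γ.inv (k t)) h) = (c.b y (t • w), q t) := by
      refine Prod.ext ?_ rfl
      rw [← c.ψ_α _ hms, Γ.α_mul _ _ hc, Γ.α_inv, hk, hy, fibreCurve, b]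
    rw [← h1, c.φ.left_inv hms]
  -- `p (y, t w, q t) = v` determines the derivative of `q`
  have hpq : (fun t : ℝ => c.p y (t • w) (q t)) =ᶠ[𝓝 0] fun _ => v := by
    filter_upwards [hcurve] with t ⟨htα, hc, ht⟩
    have h1 : c.φ.symm (y, t • w) = k t := by rw [hk, hy, fibreCurve]
    rw [p, ← ht, h1, Γ.mul_assoc _ _ _ (Γ.α_inv _).symm hc, Γ.mul_inv, htα, hεh, hyv]
  have hpd := hasDerivAt_comp_prod (f := c.p y) hp (hasDerivAt_smul_const_zero w) hqd.hasDerivAt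
    (zero_smul _ _) hq0
  -- Multiplying by an identity changes nothing, so the `v`-differential of `p` at `(0, v)` is the
  -- identity and the linearised equation can be solved for `q'(0)`.
  have hp0 : HasFDerivAt (c.p y 0) (ContinuousLinearMap.id ℝ _) v := by
    refine (hasFDerivAt_id v).congr_of_eventuallyEq ?_
    have hcont : ContinuousAt (fun v' : Fin m → ℝ => (y, v')) v := by fun_prop
    filter_upwards [hcont.eventually (c.φ.open_target.mem_nhds hyt)] with v' hv'
    rw [← hy] at hv' ⊢
    exact c.p_zero_left hεs hv'
  have hq' : deriv q 0 = -fderiv ℝ (fun z => c.p y z v) 0 w := by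
    have h1 := hpd.unique ((hasDerivAt_const (0 : ℝ) v).congr_of_eventuallyEq hpq)
    rw [hp0.fderiv, ContinuousLinearMap.id_apply] at h1
    exact eq_neg_of_add_eq_zero_right h1
  have hpu : DifferentiableAt ℝ (fun z => c.p y z v) 0 :=
    DifferentiableAt.comp (f := fun z : Fin m → ℝ => (z, v)) 0 hp (by fun_prop)
  have hbt : HasDerivAt (fun t : ℝ => c.b y (t • w)) (fderiv ℝ (c.b y) 0 w) 0 :=
    HasFDerivAt.comp_hasDerivAt (l := c.b y) 0 (by simpa using hb.hasFDerivAt)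
      (hasDerivAt_smul_const_zero w)
  have hread := c.differentiableAt_read
    ((hLd _).comp h (S.mdifferentiableAt_rightTrans hhU)) hhs hyv
  have hready : DifferentiableAt ℝ (fun z => c.read (Ld ∘ S.rightTrans) z v) y :=
    DifferentiableAt.comp (f := fun z : Fin n → ℝ => (z, v)) y hread (by fun_prop)
  have hreadv : DifferentiableAt ℝ (c.read (Ld ∘ S.rightTrans) y) v :=
    DifferentiableAt.comp (f := fun z : Fin m → ℝ => (y, z)) v hread (by fun_prop)
  have hF := hasDerivAt_comp_prod (f := c.read (Ld ∘ S.rightTrans)) hread hbt hqd.hasDerivAt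
    (by rw [zero_smul, hb0]) hq0
  have hE : (fun t => Ld (Γ.mul (Γ.inv (k t)) (S.rightTrans h))) =ᶠ[𝓝 0]
      fun t : ℝ => c.read (Ld ∘ S.rightTrans) (c.b y (t • w)) (q t) := by
    filter_upwards [hcurve] with t ⟨htα, hc, ht⟩
    rw [S.mul_rightTrans hhU hc, read, ← ht, Function.comp_apply]
  refine (hF.congr_of_eventuallyEq hE).congr_deriv ?_
  rw [hq', map_neg, ← sub_eq_add_neg, fderiv_apply_eq_sum_pderiv hready,
    fderiv_apply_eq_sum_pderiv hreadv]
  simp only [fderiv_apply_eq_sum_pderiv_pi hb, fderiv_apply_eq_sum_pderiv_pi hpu, Finset.sum_mul,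
    mul_sub, Finset.mul_sum, Finset.sum_sub_distrib]
  congr 1 <;> rw [Finset.sum_comm] <;>
    exact Finset.sum_congr rfl fun μ _ => Finset.sum_congr rfl fun γ _ => _root_.mul_assoc _ _ _

end AdaptedChart

end LieGroupoid

end

/-! ### The discrete Euler–Lagrange equations in coordinates. -/

theorem mainTheorem3
    {EM : Type*} [NormedAddCommGroup EM] [NormedSpace ℝ EM] [FiniteDimensional ℝ EM]
    {EG : Type*} [NormedAddCommGroup EG] [NormedSpace ℝ EG] [FiniteDimensional ℝ EG]
    {M : Type*} [TopologicalSpace M] [T2Space M] [ChartedSpace EM M] [IsManifold 𝓘(ℝ, EM) ∞ M]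
    {G : Type*} [TopologicalSpace G] [ChartedSpace EG G] [IsManifold 𝓘(ℝ, EG) ∞ G]
    (Γ : LieGroupoid EM EG M G)
    (Ld : G → ℝ) (hLd : MDifferentiable 𝓘(ℝ, EG) 𝓘(ℝ, ℝ) Ld)
    (g₀ h₀ : G) (x₀ : M) (hg₀ : Γ.β g₀ = x₀) (hh₀ : Γ.α h₀ = x₀)
    {n m : ℕ} (c : Γ.AdaptedChart n m)
    (W : Set G) (hsymm : Γ.IsSymmetricNhd W c.φ.source x₀)
    (S₀ Υ₀ : Γ.LocalBisection) (hg₀S : g₀ ∈ S₀.carrier) (hh₀Υ : h₀ ∈ Υ₀.carrier)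
    (hS₀ : Γ.α '' W ⊆ S₀.V) (hΥ₀ : Γ.α '' W ⊆ Υ₀.U)
    (g_W h_W : G) (hg_W : g_W ∈ W) (hh_W : h_W ∈ W)
    (x y : Fin n → ℝ) (u v : Fin m → ℝ) (hxu : c.φ g_W = (x, u)) (hyv : c.φ h_W = (y, v)) :
    Γ.IsDELSolution Ld (S₀.leftTrans g_W) (Υ₀.rightTrans h_W) ↔
      y = c.b x u ∧
      ∀ μ : Fin m,
        ∑ γ : Fin m, c.LFun γ μ x u *
            LieGroupoid.pderiv (fun u' => c.read (Ld ∘ S₀.leftTrans) x u') γ u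
          + ∑ i : Fin n, c.rhoFun i μ y *
            LieGroupoid.pderiv (fun y' => c.read (Ld ∘ Υ₀.rightTrans) y' v) i y
          - ∑ γ : Fin m, c.RFun γ μ y v *
            LieGroupoid.pderiv (fun v' => c.read (Ld ∘ Υ₀.rightTrans) y v') γ v = 0 := by
  have hgV : Γ.α g_W ∈ S₀.V := hS₀ ⟨g_W, hg_W, rfl⟩
  have hhU : Γ.β h_W ∈ Υ₀.U := hΥ₀ (hsymm.β_mem_image_α hh_W)
  have hgs := hsymm.subset hg_W
  have hhs := hsymm.subset hh_W
  have hβg : Γ.β g_W ∈ c.ψ.source := c.mem_ψ_source (hsymm.subset (hsymm.ε_β_mem _ hg_W))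
  have hb : c.b x u = c.ψ (Γ.β g_W) := by
    rw [LieGroupoid.AdaptedChart.b, ← hxu, c.φ.left_inv hgs]
  have hy : c.ψ (Γ.α h_W) = y := by rw [c.ψ_α _ hhs, hyv]
  have hβL := S₀.β_leftTrans hgV
  have hαR := Υ₀.α_rightTrans hhU
  have hcomp : Γ.β (S₀.leftTrans g_W) = Γ.α (Υ₀.rightTrans h_W) ↔ y = c.b x u := by
    rw [hβL, hαR, hb, ← hy]
    exact ⟨fun e => by rw [e], fun e => c.ψ.injOn hβg (c.α_mem _ hhs) e.symm⟩
  unfold LieGroupoid.IsDELSolution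
  rw [hcomp]
  refine and_congr_right fun hyb => ?_
  have hx₁ : Γ.β g_W = Γ.α h_W := by rw [← hβL, ← hαR, hcomp.2 hyb]
  have hεs : Γ.ε (Γ.α h_W) ∈ c.φ.source := hsymm.subset (hsymm.ε_α_mem _ hh_W)
  -- The Euler–Lagrange expression is linear in the coordinates `w` of `X` at the common point.
  have key : ∀ (X : Γ.AlgebroidSection) (w : Fin m → ℝ),
      HasVelocity (E := EG) (c.fibreCurve (c.ψ (Γ.α h_W)) w) (X.toFun (Γ.α h_W)) →
      LieGroupoid.dirDeriv Ld (S₀.leftTrans g_W) (Γ.leftInv X (S₀.leftTrans g_W))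
        - LieGroupoid.dirDeriv Ld (Υ₀.rightTrans h_W) (Γ.rightInv X (Υ₀.rightTrans h_W)) =
      ∑ μ, w μ * (∑ γ : Fin m, c.LFun γ μ x u *
            LieGroupoid.pderiv (fun u' => c.read (Ld ∘ S₀.leftTrans) x u') γ u
          + ∑ i : Fin n, c.rhoFun i μ y *
            LieGroupoid.pderiv (fun y' => c.read (Ld ∘ Υ₀.rightTrans) y' v) i y
          - ∑ γ : Fin m, c.RFun γ μ y v *
            LieGroupoid.pderiv (fun v' => c.read (Ld ∘ Υ₀.rightTrans) y v') γ v) := by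
    intro X w hX
    have h0 := c.fibreCurve_zero hεs w
    have hα := c.α_fibreCurve hεs w
    have hL := Γ.hasVelocity_leftInv X (hβL.trans hx₁) hX h0 hα
    have hR := Γ.hasVelocity_rightInv X hαR hX h0 hα
    have hL' := (LieGroupoid.hasDerivAt_dirDeriv (hLd _) hL
      (by rw [h0, ← hx₁, ← hβL, Γ.mul_ε])).unique
      (c.hasDerivAt_mul_leftTrans hsymm hLd S₀ hS₀ hg_W hxu hx₁ w)
    have hR' := (LieGroupoid.hasDerivAt_dirDeriv (hLd _) hR
      (by rw [h0, Γ.inv_ε, ← hαR, Γ.ε_mul])).unique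
      (c.hasDerivAt_mul_inv_rightTrans hsymm hLd Υ₀ hΥ₀ hh_W hyv rfl w)
    -- `hR'` concerns the negative of the right-invariant vector, which turns the difference of
    -- derivatives into a sum.
    have hneg : LieGroupoid.dirDeriv Ld (Υ₀.rightTrans h_W)
        (-(Γ.rightInv X (Υ₀.rightTrans h_W))) =
        -LieGroupoid.dirDeriv Ld (Υ₀.rightTrans h_W) (Γ.rightInv X (Υ₀.rightTrans h_W)) :=
      map_neg (mfderiv 𝓘(ℝ, EG) 𝓘(ℝ, ℝ) Ld (Υ₀.rightTrans h_W)) _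
    rw [hneg] at hR'
    rw [sub_eq_add_neg, hL', hR', ← Finset.sum_add_distrib]
    exact Finset.sum_congr rfl fun μ _ => by ring
  constructor
  · intro hDEL μ
    -- The basis vector `e_μ` isolates the equation of index `μ`.
    obtain ⟨X, hX⟩ := c.exists_section_hasVelocity_fibreCurve hεs (Pi.single μ 1)
    have h := (key X _ hX).symm.trans (hDEL X)
    simpa [Pi.single_apply] using h
  · intro hE X
    obtain ⟨w, hw⟩ := c.exists_hasVelocity_fibreCurve hεs (X.vertical (Γ.α h_W))
    rw [key X w hw]
    exact Finset.sum_eq_zero fun μ _ => by rw [hE μ, mul_zero]
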